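/- Let $k$ be a field, let $X$ be a smooth, separated scheme of finite type over $k$ (for instance a smooth variety), and let $R\subset X$ be a closed subscheme that is finite over $k$. A finite $k$-scheme $R$ is called \emph{abstractly smoothable} if there exist an irreducible locally Noetherian $k$-scheme $T$, a $k$-rational point $t\in T$ and a finite flat morphism $\mathcal Z\to T$ such that the fibre $\mathcal Z_t$ is isomorphic to $R$ as a $k$-scheme and the fibre $\mathcal Z_\eta$ over the generic point $\eta$ of $T$ is smooth over the residue field $\kappa(\eta)$. A finite closed subscheme $R\subset X$ is called \emph{embedded smoothable in $X$} if there exist such $T$, $t$ and $\mathcal Z\to T$ where, moreover, $\mathcal Z$ is a closed subscheme of $X\times_k T$, the morphism $\mathcal Z\to T$ is the restriction of the projection, and $\mathcal Z_t=R$ as subschemes of $X$. The following conditions are equivalent: \begin{enumerate} \item $R$ is abstractly smoothable; \item $R$ is embedded smoothable in $X$; \item every connected component of $R$ is abstractly smoothable; \item every connected component of $R$ is embedded smoothable in $X$. \end{enumerate} -/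

import Mathlib

open CategoryTheory CategoryTheory.Limits AlgebraicGeometry

universe u

namespace Smoothability

/-- Let `f : R ⟶ Spec k` and `q : T ⟶ Spec k` be `k`-schemes. The morphism `π : Z ⟶ T`, together
with the `k`-rational point `t` of `T` and the morphism `i : R ⟶ Z`, is an abstract smoothing
of `R`: the base `T` is irreducible and locally Noetherian, `π` is finite and flat, `i` identifies
`R` (as a `k`-scheme) with the fibre of `π` over `t`, and the fibre of `π` over the generic
point `η` of `T` is smooth over the residue field of `η`. -/
structure IsAbstractSmoothing {k : Type u} [Field k] {R Z T : Scheme.{u}}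
    (f : R ⟶ Spec (.of k)) (q : T ⟶ Spec (.of k)) (π : Z ⟶ T) (t : Spec (.of k) ⟶ T)
    (i : R ⟶ Z) : Prop where
  irreducible : IrreducibleSpace T
  locallyNoetherian : IsLocallyNoetherian T
  rational : t ≫ q = 𝟙 (Spec (.of k))
  finite : IsFinite π
  flat : Flat π
  isPullback : IsPullback i f π t
  smooth_generic : Smooth (π.fiberToSpecResidueField (genericPoint T))

/-- The `k`-scheme `f : R ⟶ Spec k` is abstractly smoothable. -/
def AbstractlySmoothable {k : Type u} [Field k] {R : Scheme.{u}} (f : R ⟶ Spec (.of k)) : Prop :=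
  ∃ (T Z : Scheme.{u}) (q : T ⟶ Spec (.of k)) (π : Z ⟶ T) (t : Spec (.of k) ⟶ T) (i : R ⟶ Z),
    IsAbstractSmoothing f q π t i

/-- The subscheme `ι : R ⟶ X` of the `k`-scheme `p : X ⟶ Spec k` is smoothable in `X`: there is a
closed subscheme `j : Z ⟶ X ×ₖ T` such that `Z ⟶ T` is an abstract smoothing of `R`, where the
fibre of `Z` over the special point is `R` as a subscheme of `X`. -/
def EmbeddedSmoothable {k : Type u} [Field k] {R X : Scheme.{u}} (p : X ⟶ Spec (.of k))
    (ι : R ⟶ X) : Prop :=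
  ∃ (T Z : Scheme.{u}) (q : T ⟶ Spec (.of k)) (j : Z ⟶ pullback p q)
    (t : Spec (.of k) ⟶ T) (i : R ⟶ Z),
    IsClosedImmersion j ∧
    IsAbstractSmoothing (ι ≫ p) q (j ≫ pullback.snd p q) t i ∧
    i ≫ j ≫ pullback.fst p q = ι

/-- A finite scheme over a field is a discrete space. -/
theorem discreteTopology_of_isFinite {k : Type u} [Field k] {R : Scheme.{u}}
    (f : R ⟶ Spec (.of k)) [IsFinite f] : DiscreteTopology R := by
  have h := f.isDiscrete_preimage (isDiscrete_univ_iff.mpr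
    (inferInstanceAs (DiscreteTopology (PrimeSpectrum k))))
  rwa [Set.preimage_univ, isDiscrete_univ_iff] at h

/-- The connected component of the point `x` of a finite `k`-scheme `R`, as an open subscheme. -/
def component {k : Type u} [Field k] {R : Scheme.{u}} (f : R ⟶ Spec (.of k)) [IsFinite f]
    (x : R) : R.Opens where
  carrier := connectedComponent x
  is_open' := by
    have := discreteTopology_of_isFinite f
    exact isOpen_discrete _

end Smoothability

-- Everything rests on one extension principle (`mapSmoothable_of_formallySmooth`): a `k`-morphism
-- from `R` to a smooth affine scheme `Spec S` extends to the total space of an abstract smoothing,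
-- after a base change that keeps the marked point and the generic point. If the smoothing is `Spec
-- B → Spec A` with `B` finite free over `A`, the Weil restriction of `S` along `A → B` represents
-- `C ↦ Hom_k(S, C ⊗[A] B)`. It inherits the infinitesimal lifting property from `S`, so it is
-- smooth, hence flat, over `A`. The given morphism is a `k`-point of it; an irreducible component
-- through that point dominates `Spec A` by flatness, and over it the universal homomorphism
-- provides the extension. Such an `A` exists: pass to a local ring of the base, where flat means
-- free, and then descend to finite type.
--
-- The principle is used twice. With `S = k × k`, a clopen decomposition of `R` extends to the
-- smoothing, so clopen subschemes of `R` are abstractly smoothable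
-- (`AbstractlySmoothable.of_isClosed`). With `Spec S` an affine open of `X`, the inclusion of a
-- point component extends to a smoothing; disjoint unions over a common base then treat all of `R`.
-- Over a local base, Nakayama's lemma turns the extended morphism into a closed immersion
-- (`isClosedImmersion_of_mono`), which gives embedded smoothability.

attribute [local simp] pullback.lift_fst pullback.lift_snd coprod.inl_desc coprod.inr_desc
  coprod.inl_map coprod.inr_map pullback.lift_fst_assoc pullback.lift_snd_assoc
  coprod.inl_desc_assoc coprod.inr_desc_assoc coprod.inl_map_assoc coprod.inr_map_assoc

namespace Smoothability

/-! ### Base change, clopen restriction and disjoint union of smoothings. -/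

/-- Abstract smoothings are stable under base change along morphisms of bases which respect the
marked points and the generic points. -/
theorem IsAbstractSmoothing.of_isPullback {k : Type u} [Field k] {R Z T T' Z' : Scheme.{u}}
    {f : R ⟶ Spec (.of k)} {q : T ⟶ Spec (.of k)} {π : Z ⟶ T} {t : Spec (.of k) ⟶ T} {i : R ⟶ Z}
    (h : IsAbstractSmoothing f q π t i) {g : T' ⟶ T} {q' : T' ⟶ Spec (.of k)} {π' : Z' ⟶ T'}
    {g' : Z' ⟶ Z} {t' : Spec (.of k) ⟶ T'} {i' : R ⟶ Z'} (hT' : IrreducibleSpace T')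
    (hN : IsLocallyNoetherian T') (hZ : IsPullback g' π' π g) (hq : g ≫ q = q') (ht : t' ≫ g = t)
    (hi : i' ≫ g' = i) (hi' : i' ≫ π' = f ≫ t')
    (hη : g (genericPoint T') = @genericPoint T _ _ h.irreducible) :
    IsAbstractSmoothing f q' π' t' i' where
  irreducible := hT'
  locallyNoetherian := hN
  rational := by rw [← hq, ← Category.assoc, ht, h.rational]
  finite := MorphismProperty.of_isPullback hZ h.finite
  flat := MorphismProperty.of_isPullback hZ h.flat
  isPullback := by
    subst ht hi
    exact IsPullback.of_right h.isPullback hi' hZ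
  smooth_generic := by
    have := h.irreducible
    have hs := h.smooth_generic
    rw [← hη] at hs
    exact MorphismProperty.of_isPullback
      (isPullback_fiberToSpecResidueField_of_isPullback hZ (genericPoint T')) hs

/-- The restriction of an abstract smoothing to an open and closed subscheme of the total space. -/
theorem IsAbstractSmoothing.restrict {k : Type u} [Field k] {R Z T : Scheme.{u}}
    {f : R ⟶ Spec (.of k)} {q : T ⟶ Spec (.of k)} {π : Z ⟶ T} {t : Spec (.of k) ⟶ T} {i : R ⟶ Z}
    (h : IsAbstractSmoothing f q π t i) (V : Z.Opens) (hV : IsClosed (V : Set Z)) :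
    IsAbstractSmoothing ((i ⁻¹ᵁ V).ι ≫ f) q (V.ι ≫ π) t (i ∣_ V) := by
  have := h.irreducible
  have : IsClosedImmersion V.ι := by
    refine IsClosedImmersion.of_isPreimmersion _ ?_
    simpa using hV
  have := h.finite
  have := h.flat
  refine ⟨h.irreducible, h.locallyNoetherian, h.rational, inferInstance, inferInstance, ?_, ?_⟩
  · exact (isPullback_morphismRestrict i V).flip.paste_horiz h.isPullback.flip |>.flip
  · have := h.smooth_generic
    let r : (V.ι ≫ π).fiber (genericPoint T) ⟶ π.fiber (genericPoint T) :=
      pullback.lift ((V.ι ≫ π).fiberι _ ≫ V.ι) ((V.ι ≫ π).fiberToSpecResidueField _)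
        (by simpa using (V.ι ≫ π).fiber_fac _)
    have hr₁ : r ≫ π.fiberι _ = (V.ι ≫ π).fiberι _ ≫ V.ι := pullback.lift_fst _ _ _
    have hr₂ : r ≫ π.fiberToSpecResidueField _ = (V.ι ≫ π).fiberToSpecResidueField _ :=
      pullback.lift_snd _ _ _
    -- The generic fibre of `V` is the preimage of `V` in the generic fibre of `Z`, hence open in
    -- it, and smoothness restricts to opens.
    have hp : IsPullback r ((V.ι ≫ π).fiberι (genericPoint T)) (π.fiberι (genericPoint T)) V.ι := by
      refine IsPullback.of_right (h₁₂ := π.fiberToSpecResidueField (genericPoint T))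
        (v₁₃ := T.fromSpecResidueField (genericPoint T)) 
        (h₂₂ := π) ?_ hr₁ (IsPullback.of_hasPullback _ _).flip
      rw [hr₂]
      exact (IsPullback.of_hasPullback _ _).flip
    have : IsOpenImmersion r := MorphismProperty.of_isPullback hp.flip inferInstance
    rw [← hr₂]
    infer_instance

/-- Pullbacks of schemes commute with binary coproducts. -/
theorem isPullback_of_isColimit_binaryCofan {Z₁ Z₂ W₁ W₂ W S T : Scheme.{u}}
    {π₁ : Z₁ ⟶ T} {π₂ : Z₂ ⟶ T} {s : S ⟶ T}
    {a₁ : W₁ ⟶ Z₁} {b₁ : W₁ ⟶ S} {a₂ : W₂ ⟶ Z₂} {b₂ : W₂ ⟶ S}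
    (h₁ : IsPullback a₁ b₁ π₁ s) (h₂ : IsPullback a₂ b₂ π₂ s)
    {w₁ : W₁ ⟶ W} {w₂ : W₂ ⟶ W} (hW : IsColimit (BinaryCofan.mk w₁ w₂))
    {a : W ⟶ Z₁ ⨿ Z₂} {b : W ⟶ S} (ha₁ : w₁ ≫ a = a₁ ≫ coprod.inl)
    (ha₂ : w₂ ≫ a = a₂ ≫ coprod.inr) (hb₁ : w₁ ≫ b = b₁) (hb₂ : w₂ ≫ b = b₂) :
    IsPullback a b (coprod.desc π₁ π₂) s := by
  have hP := IsPullback.of_hasPullback (coprod.desc π₁ π₂) s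
  let l₁ : W₁ ⟶ pullback (coprod.desc π₁ π₂) s :=
    pullback.lift (a₁ ≫ coprod.inl) b₁ (by rw [Category.assoc, coprod.inl_desc, h₁.w])
  let l₂ : W₂ ⟶ pullback (coprod.desc π₁ π₂) s :=
    pullback.lift (a₂ ≫ coprod.inr) b₂ (by rw [Category.assoc, coprod.inr_desc, h₂.w])
  have hl₁ : IsPullback l₁ a₁ (pullback.fst _ _) coprod.inl := by
    refine IsPullback.of_right ?_ (by simp [l₁]) hP.flip
    simpa [l₁] using h₁.flip
  have hl₂ : IsPullback l₂ a₂ (pullback.fst _ _) coprod.inr := by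
    refine IsPullback.of_right ?_ (by simp [l₂]) hP.flip
    simpa [l₂] using h₂.flip
  have : IsOpenImmersion l₁ := MorphismProperty.of_isPullback hl₁.flip inferInstance
  have : IsOpenImmersion l₂ := MorphismProperty.of_isPullback hl₂.flip inferInstance
  -- The images of `l₁` and `l₂` are the preimages of the two complementary summands, so they
  -- decompose the pullback.
  obtain ⟨hc⟩ := nonempty_isColimit_binaryCofanMk_of_isCompl l₁ l₂ (by
    have e₁ : l₁.opensRange = pullback.fst (coprod.desc π₁ π₂) s ⁻¹ᵁ
        (coprod.inl (X := Z₁) (Y := Z₂)).opensRange := by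
      rw [← Scheme.Hom.opensRange_pullbackFst]
      rw [← Scheme.Hom.opensRange_comp_of_isIso hl₁.isoPullback.hom]
      congr 1
      exact hl₁.isoPullback_hom_fst.symm
    have e₂ : l₂.opensRange = pullback.fst (coprod.desc π₁ π₂) s ⁻¹ᵁ
        (coprod.inr (X := Z₁) (Y := Z₂)).opensRange := by
      rw [← Scheme.Hom.opensRange_pullbackFst]
      rw [← Scheme.Hom.opensRange_comp_of_isIso hl₂.isoPullback.hom]
      congr 1
      exact hl₂.isoPullback_hom_fst.symm
    have hc := isCompl_opensRange_inl_inr Z₁ Z₂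
    rw [e₁, e₂]
    constructor
    · rw [disjoint_iff, ← Scheme.Hom.preimage_inf, hc.inf_eq_bot, Scheme.Hom.preimage_bot]
    · rw [codisjoint_iff, ← Scheme.Hom.preimage_sup, hc.sup_eq_top, Scheme.Hom.preimage_top])
  obtain ⟨e, he₁, he₂⟩ : ∃ e : W ≅ pullback (coprod.desc π₁ π₂) s, w₁ ≫ e.hom = l₁ ∧
      w₂ ≫ e.hom = l₂ :=
    ⟨hW.coconePointUniqueUpToIso hc, hW.comp_coconePointUniqueUpToIso_hom hc ⟨.left⟩,
      hW.comp_coconePointUniqueUpToIso_hom hc ⟨.right⟩⟩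
  have hext {V : Scheme.{u}} (x y : W ⟶ V) (hx₁ : w₁ ≫ x = w₁ ≫ y) (hx₂ : w₂ ≫ x = w₂ ≫ y) :
      x = y := BinaryCofan.IsColimit.hom_ext hW hx₁ hx₂
  refine IsPullback.of_iso_pullback ⟨hext _ _ ?_ ?_⟩ e (hext _ _ ?_ ?_) (hext _ _ ?_ ?_)
  · simpa [reassoc_of% ha₁, reassoc_of% hb₁] using h₁.w
  · simpa [reassoc_of% ha₂, reassoc_of% hb₂] using h₂.w
  · simp [reassoc_of% he₁, ha₁, l₁]
  · simp [reassoc_of% he₂, ha₂, l₂]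
  · simp [reassoc_of% he₁, hb₁, l₁]
  · simp [reassoc_of% he₂, hb₂, l₂]

theorem coprodDesc_of_isZariskiLocalAtSource (P : MorphismProperty Scheme.{u})
    (hP : IsZariskiLocalAtSource P) {Z₁ Z₂ T : Scheme.{u}} {π₁ : Z₁ ⟶ T} {π₂ : Z₂ ⟶ T}
    (h₁ : P π₁) (h₂ : P π₂) : P (coprod.desc π₁ π₂) := by
  rw [IsZariskiLocalAtSource.iff_of_openCover (P := P) (coprodOpenCover.{u, 0} Z₁ Z₂)]
  rintro (x | x)
  · simpa [coprodOpenCover] using h₁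
  · simpa [coprodOpenCover] using h₂

/-- The disjoint union of two abstract smoothings over the same base. -/
theorem IsAbstractSmoothing.coprod {k : Type u} [Field k] {R R₁ R₂ Z₁ Z₂ T : Scheme.{u}}
    {f : R ⟶ Spec (.of k)} {q : T ⟶ Spec (.of k)} {π₁ : Z₁ ⟶ T} {π₂ : Z₂ ⟶ T}
    {t : Spec (.of k) ⟶ T} {r₁ : R₁ ⟶ R} {r₂ : R₂ ⟶ R} {i₁ : R₁ ⟶ Z₁} {i₂ : R₂ ⟶ Z₂}
    (h₁ : IsAbstractSmoothing (r₁ ≫ f) q π₁ t i₁) (h₂ : IsAbstractSmoothing (r₂ ≫ f) q π₂ t i₂)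
    (hR : IsColimit (BinaryCofan.mk r₁ r₂)) {i : R ⟶ Z₁ ⨿ Z₂} (hi₁ : r₁ ≫ i = i₁ ≫ coprod.inl)
    (hi₂ : r₂ ≫ i = i₂ ≫ coprod.inr) :
    IsAbstractSmoothing f q (coprod.desc π₁ π₂) t i where
  irreducible := h₁.irreducible
  locallyNoetherian := h₁.locallyNoetherian
  rational := h₁.rational
  finite := by
    have := h₁.finite
    have := h₂.finite
    infer_instance
  flat := coprodDesc_of_isZariskiLocalAtSource @Flat
    HasRingHomProperty.instIsZariskiLocalAtSource h₁.flat h₂.flat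
  isPullback := isPullback_of_isColimit_binaryCofan h₁.isPullback h₂.isPullback hR hi₁ hi₂ rfl rfl
  smooth_generic := by
    have := h₁.irreducible
    have h := isPullback_of_isColimit_binaryCofan
      (IsPullback.of_hasPullback π₁ (T.fromSpecResidueField (genericPoint T)))
      (IsPullback.of_hasPullback π₂ (T.fromSpecResidueField (genericPoint T)))
      (coprodIsCoprod _ _) (coprod.inl_map _ _) (coprod.inr_map _ _)
      (coprod.inl_desc _ _) (coprod.inr_desc _ _)
    have hs := coprodDesc_of_isZariskiLocalAtSource @Smooth
      HasRingHomProperty.instIsZariskiLocalAtSource h₁.smooth_generic h₂.smooth_generic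
    change Smooth (pullback.snd _ _)
    rw [← h.isoPullback_inv_snd]
    have := MorphismProperty.IsStableUnderBaseChange.respectsIso (P := @Smooth.{u})
    exact (MorphismProperty.cancel_left_of_respectsIso @Smooth _ _).mpr hs

/-! ### Flatness over domains and Weil restriction along a finite free algebra. -/

open scoped TensorProduct

/-- A nonzero element of a domain `A` stays nonzero modulo a minimal prime of a flat algebra. -/
theorem algebraMap_quotient_injective_of_mem_minimalPrimes {A C : Type*} [CommRing A] [IsDomain A]
    [CommRing C] [Algebra A C] [Module.Flat A C] {P : Ideal C} (hP : P ∈ minimalPrimes C) :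
    Function.Injective (algebraMap A (C ⧸ P)) := by
  rw [injective_iff_map_eq_zero]
  intro a ha
  rw [IsScalarTower.algebraMap_apply A C (C ⧸ P), Ideal.Quotient.algebraMap_eq,
    Ideal.Quotient.eq_zero_iff_mem] at ha
  by_contra h0
  -- Elements of a minimal prime are zero divisors, whereas flatness keeps a nonzero `a` regular on
  -- `C`.
  refine notMem_nonZeroDivisors_of_mem_mem_minimalPrimes ha hP ?_
  have h : IsSMulRegular C a :=
    Module.Flat.isSMulRegular_of_isRegular (IsRegular.of_ne_zero h0)
  rw [mem_nonZeroDivisors_iff_left]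
  intro x hx
  refine h.right_eq_zero_of_smul ?_
  rwa [Algebra.smul_def]

section WeilRestriction

variable {A B : Type*} [CommRing A] [CommRing B] [Algebra A B] {κ : Type*}
  (b : Module.Basis κ A B)

theorem basis_repr_tensorProductMap {P C : Type*} [CommRing P] [Algebra A P] [CommRing C]
    [Algebra A C] (ψ : P →ₐ[A] C) (x : P ⊗[A] B) (s : κ) :
    (Algebra.TensorProduct.basis C b).repr
      (Algebra.TensorProduct.map ψ (AlgHom.id A B) x) s =
      ψ ((Algebra.TensorProduct.basis P b).repr x s) := by
  induction x with
  | zero => simp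
  | add x y hx hy => simp [hx, hy]
  | tmul p y => simp [Algebra.TensorProduct.basis_repr_tmul]

theorem tensorProductMap_map {P C D : Type*} [CommRing P] [Algebra A P] [CommRing C] [Algebra A C]
    [CommRing D] [Algebra A D] (ψ : P →ₐ[A] C) (χ : C →ₐ[A] D) (x : P ⊗[A] B) :
    Algebra.TensorProduct.map χ (AlgHom.id A B) (Algebra.TensorProduct.map ψ (AlgHom.id A B) x) =
      Algebra.TensorProduct.map (χ.comp ψ) (AlgHom.id A B) x := by
  induction x with
  | zero => simp
  | add x y hx hy => simp only [map_add, hx, hy]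
  | tmul p y => simp

variable {k : Type*} [CommRing k] [Algebra k A]
variable {S : Type*} [CommRing S] [Algebra k S] {σ : Type*}

/-- The universal point of the Weil restriction of an affine space. -/
noncomputable def weilPoint (k : Type*) [CommRing k] [Algebra k A] (σ : Type*) [Fintype κ] :
    MvPolynomial σ k →ₐ[k] MvPolynomial (σ × κ) A ⊗[A] B :=
  MvPolynomial.aeval fun i ↦ ∑ s, MvPolynomial.X (i, s) ⊗ₜ b s

variable [Fintype κ]

/-- The ideal of the Weil restriction along `A → B` of the closed subscheme of affine space that
is defined by `f`. -/
noncomputable def weilIdeal (f : MvPolynomial σ k →ₐ[k] S) : Ideal (MvPolynomial (σ × κ) A) :=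
  Ideal.span {c | ∃ x s, f x = 0 ∧
    c = (Algebra.TensorProduct.basis (MvPolynomial (σ × κ) A) b).repr (weilPoint b k σ x) s}

/-- The coordinate ring of the Weil restriction along `A → B` of the closed subscheme of affine
space that is defined by `f`. -/
abbrev WeilRestriction (f : MvPolynomial σ k →ₐ[k] S) : Type _ :=
  MvPolynomial (σ × κ) A ⧸ weilIdeal b f

variable (f : MvPolynomial σ k →ₐ[k] S)

theorem tensorProductMap_weilPoint_eq_zero (x : MvPolynomial σ k) (hx : f x = 0) :
    Algebra.TensorProduct.map (Ideal.Quotient.mkₐ A (weilIdeal b f)) (AlgHom.id A B)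
      (weilPoint b k σ x) = 0 := by
  apply (Algebra.TensorProduct.basis (WeilRestriction b f) b).repr.injective
  ext s
  rw [basis_repr_tensorProductMap, map_zero, Finsupp.coe_zero, Pi.zero_apply]
  exact Ideal.Quotient.eq_zero_iff_mem.mpr (Ideal.subset_span ⟨x, s, hx, rfl⟩)

/-- The universal morphism from the Weil restriction. -/
noncomputable def weilUniversal (hf : Function.Surjective f) :
    S →ₐ[k] WeilRestriction b f ⊗[A] B :=
  AlgHom.liftOfSurjective (C := WeilRestriction b f ⊗[A] B) f hf
    (((Algebra.TensorProduct.map (Ideal.Quotient.mkₐ A (weilIdeal b f))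
      (AlgHom.id A B)).restrictScalars k).comp (weilPoint b k σ))
    fun x hx ↦ tensorProductMap_weilPoint_eq_zero b f x hx

theorem weilUniversal_apply (hf : Function.Surjective f) (x : MvPolynomial σ k) :
    weilUniversal b f hf (f x) =
      Algebra.TensorProduct.map (Ideal.Quotient.mkₐ A (weilIdeal b f)) (AlgHom.id A B)
        (weilPoint b k σ x) := by
  exact AlgHom.liftOfSurjective_apply f hf _ _ x

/-- Existence half of the universal property. The variable `(i, s)` is sent to the `s`-th coordinate
of the image of the `i`-th generator of `S`; the relations vanish because they are coordinates of
elements that `h` kills. -/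
theorem exists_weilRestriction_lift (hf : Function.Surjective f) {C : Type*} [CommRing C]
    [Algebra A C] [Algebra k C]
    [IsScalarTower k A C] (h : S →ₐ[k] C ⊗[A] B) :
    ∃ w : WeilRestriction b f →ₐ[A] C, ∀ x,
      Algebra.TensorProduct.map w (AlgHom.id A B) (weilUniversal b f hf x) = h x := by
  let bC := Algebra.TensorProduct.basis C b
  let ψ : MvPolynomial (σ × κ) A →ₐ[A] C :=
    MvPolynomial.aeval fun i ↦ bC.repr (h (f (MvPolynomial.X i.1))) i.2
  have hψ : ((Algebra.TensorProduct.map ψ (AlgHom.id A B)).restrictScalars k).comp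
      (weilPoint b k σ) = h.comp f := by
    ext i
    simp only [weilPoint, AlgHom.comp_apply, MvPolynomial.aeval_X, map_sum,
      AlgHom.restrictScalars_apply, Algebra.TensorProduct.map_tmul, ψ, AlgHom.id_apply]
    conv_rhs => rw [← bC.sum_repr (h (f (MvPolynomial.X i)))]
    simp [bC, TensorProduct.smul_tmul']
  have hψ' (x) : Algebra.TensorProduct.map ψ (AlgHom.id A B) (weilPoint b k σ x) = h (f x) :=
    DFunLike.congr_fun hψ x
  let w : WeilRestriction b f →ₐ[A] C := Ideal.Quotient.liftₐ _ ψ <| by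
    intro x hx
    rw [← RingHom.mem_ker]
    revert x
    change weilIdeal b f ≤ RingHom.ker ψ
    rw [weilIdeal, Ideal.span_le]
    rintro _ ⟨x, s, hx, rfl⟩
    rw [SetLike.mem_coe, RingHom.mem_ker, ← basis_repr_tensorProductMap, hψ', hx]
    simp
  have hw : w.comp (Ideal.Quotient.mkₐ A (weilIdeal b f)) = ψ := Ideal.Quotient.liftₐ_comp _ _ _
  refine ⟨w, fun y ↦ ?_⟩
  obtain ⟨x, rfl⟩ := hf y
  rw [weilUniversal_apply, ← hψ', ← hw]
  rw [tensorProductMap_map]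

/-- Uniqueness half: the image of the variable `(i, s)` can be read off as a basis coordinate of the
image of the `i`-th generator. -/
theorem weilRestriction_hom_ext (hf : Function.Surjective f) {C : Type*} [CommRing C] [Algebra A C]
    {w₁ w₂ : WeilRestriction b f →ₐ[A] C}
    (h : ∀ x, Algebra.TensorProduct.map w₁ (AlgHom.id A B) (weilUniversal b f hf x) =
      Algebra.TensorProduct.map w₂ (AlgHom.id A B) (weilUniversal b f hf x)) : w₁ = w₂ := by
  classical
  refine Ideal.Quotient.algHom_ext _ (MvPolynomial.algHom_ext fun ⟨i, s⟩ ↦ ?_)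
  have hi := congr((Algebra.TensorProduct.basis C b).repr $(h (f (MvPolynomial.X i))) s)
  simp only [weilUniversal_apply, weilPoint, MvPolynomial.aeval_X, map_sum] at hi
  simpa [Finsupp.single_apply] using hi

theorem ker_tensorProductMap_mk_sq {C : Type*} [CommRing C] [Algebra A C] (I : Ideal C)
    (hI : I ^ 2 = ⊥) :
    RingHom.ker (Algebra.TensorProduct.map (Ideal.Quotient.mkₐ A I) (AlgHom.id A B)) ^ 2 = ⊥ := by
  rw [Algebra.TensorProduct.map_ker _ _ (Ideal.Quotient.mkₐ_surjective A I)
    Function.surjective_id]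
  have hI' : RingHom.ker (Ideal.Quotient.mkₐ A I) = I := Ideal.Quotient.mkₐ_ker A I
  have : RingHom.ker (AlgHom.id A B) = ⊥ := by
    ext; simp
  rw [hI', this, Ideal.map_bot, sup_bot_eq, ← Ideal.map_pow, hI, Ideal.map_bot]

/-- By the universal property, lifting a point along `C → C ⧸ I` means lifting a homomorphism from
`S` along `C ⊗[A] B → (C ⧸ I) ⊗[A] B`. This is again surjective with square-zero kernel, so formal
smoothness of `S` applies. -/
theorem formallySmooth_weilRestriction (hf : Function.Surjective f) [Algebra.FormallySmooth k S] :
    Algebra.FormallySmooth A (WeilRestriction b f) := by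
  refine Algebra.FormallySmooth.of_comp_surjective fun C _ _ I hI w ↦ ?_
  let _ : Algebra k C := Algebra.compHom C (algebraMap k A)
  have : IsScalarTower k A C := .of_algebraMap_eq fun _ ↦ rfl
  have hr : Function.Surjective
      (Algebra.TensorProduct.map (Ideal.Quotient.mkₐ A I) (AlgHom.id A B)) :=
    TensorProduct.map_surjective (Ideal.Quotient.mkₐ_surjective A I) Function.surjective_id
  obtain ⟨h, hh⟩ : ∃ h : S →ₐ[k] C ⊗[A] B, ∀ x,
      Algebra.TensorProduct.map (Ideal.Quotient.mkₐ A I) (AlgHom.id A B) (h x) =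
      Algebra.TensorProduct.map w (AlgHom.id A B) (weilUniversal b f hf x) :=
    ⟨_, fun x ↦ Algebra.FormallySmooth.liftOfSurjective_apply
      (((Algebra.TensorProduct.map w (AlgHom.id A B)).restrictScalars k).comp
        (weilUniversal b f hf))
      ((Algebra.TensorProduct.map (Ideal.Quotient.mkₐ A I) (AlgHom.id A B)).restrictScalars k)
      hr ⟨2, ker_tensorProductMap_mk_sq I hI⟩ x⟩
  obtain ⟨w', hw'⟩ := exists_weilRestriction_lift b f hf h
  refine ⟨w', weilRestriction_hom_ext b f hf fun x ↦ ?_⟩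
  rw [← hh, ← hw', tensorProductMap_map]

end WeilRestriction

/-- `W` is the Weil restriction. As `A` is Noetherian, finite type gives finite presentation;
together with formal smoothness this makes `W` smooth, hence flat. -/
theorem exists_flat_algebra_of_formallySmooth {k A B S C : Type u} [CommRing k] [CommRing A]
    [IsNoetherianRing A] [Algebra k A] [CommRing B] [Algebra A B] [Module.Free A B]
    [Module.Finite A B] [CommRing S] [Algebra k S] [Algebra.FiniteType k S]
    [Algebra.FormallySmooth k S] [CommRing C] [Algebra A C] [Algebra k C] [IsScalarTower k A C]
    (h : S →ₐ[k] C ⊗[A] B) :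
    ∃ (W : Type u) (_ : CommRing W) (_ : Algebra k W) (_ : Algebra A W) (_ : IsScalarTower k A W)
      (v : S →ₐ[k] W ⊗[A] B) (w : W →ₐ[A] C), Algebra.FiniteType A W ∧ Module.Flat A W ∧
      ∀ x, Algebra.TensorProduct.map w (AlgHom.id A B) (v x) = h x := by
  obtain ⟨n, s, hs⟩ := Algebra.FiniteType.iff_quotient_mvPolynomial''.mp
    (inferInstance : Algebra.FiniteType k S)
  let b := Module.Free.chooseBasis A B
  have : Algebra.FormallySmooth A (WeilRestriction b s) := formallySmooth_weilRestriction b s hs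
  have : Algebra.Smooth A (WeilRestriction b s) :=
    ⟨inferInstance, Algebra.FinitePresentation.of_finiteType.mp inferInstance⟩
  obtain ⟨w, hw⟩ := exists_weilRestriction_lift b s hs h
  exact ⟨WeilRestriction b s, inferInstance, inferInstance, inferInstance, inferInstance,
    weilUniversal b s hs, w, inferInstance, inferInstance, hw⟩

/-! ### Extending morphisms into smooth affine schemes over a smoothing. -/

/-- A homomorphism from a smooth `k`-algebra `S` to the special fibre of a finite free algebra `B`
over a domain `A` lifts to the base change of `B` to a domain that dominates `A`. -/
theorem exists_domain_of_formallySmooth {k A B S : Type u} [Field k] [CommRing A] [IsDomain A]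
    [Algebra k A] [Algebra.FiniteType k A] [Algebra A k] [IsScalarTower k A k] [CommRing B]
    [Algebra A B] [Module.Free A B] [Module.Finite A B] [CommRing S] [Algebra k S]
    [Algebra.FiniteType k S] [Algebra.FormallySmooth k S] (h : S →ₐ[k] k ⊗[A] B) :
    ∃ (A' : Type u) (_ : CommRing A') (_ : IsDomain A') (_ : Algebra k A') (_ : Algebra A A')
      (_ : IsScalarTower k A A') (v : S →ₐ[k] A' ⊗[A] B) (w : A' →ₐ[A] k),
      Algebra.FiniteType k A' ∧ Function.Injective (algebraMap A A') ∧
      ∀ x, Algebra.TensorProduct.map w (AlgHom.id A B) (v x) = h x := by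
  have : IsNoetherianRing A := Algebra.FiniteType.isNoetherianRing k A
  obtain ⟨W, _, _, _, _, v, w, hW, _, hw⟩ := exists_flat_algebra_of_formallySmooth h
  have hwp : (RingHom.ker w).IsPrime := RingHom.ker_isPrime w
  -- An irreducible component through the given `k`-point: `W ⧸ P` is a domain, and `w` factors
  -- through it.
  obtain ⟨P, hP, hPw⟩ := Ideal.exists_minimalPrimes_le (I := ⊥) (J := RingHom.ker w) bot_le
  have := hP.isPrime
  have : Algebra.FiniteType k W := Algebra.FiniteType.trans (S := A) inferInstance hW
  let w' : W ⧸ P →ₐ[A] k := Ideal.Quotient.liftₐ P w fun x hx ↦ hPw hx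
  have hw' : w'.comp (Ideal.Quotient.mkₐ A P) = w := Ideal.Quotient.liftₐ_comp _ _ _
  refine ⟨W ⧸ P, inferInstance, inferInstance, inferInstance, inferInstance, inferInstance,
    ((Algebra.TensorProduct.map (Ideal.Quotient.mkₐ A P) (AlgHom.id A B)).restrictScalars k).comp v,
    w', Algebra.FiniteType.of_surjective (Ideal.Quotient.mkₐ k P)
      (Ideal.Quotient.mkₐ_surjective k P),
    algebraMap_quotient_injective_of_mem_minimalPrimes hP, fun x ↦ ?_⟩
  rw [← hw x, ← hw', ← tensorProductMap_map]
  rfl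

theorem specMap_genericPoint {A A' : Type u} [CommRing A] [IsDomain A] [CommRing A'] [IsDomain A']
    (ψ : A →+* A') (hψ : Function.Injective ψ) :
    Spec.map (CommRingCat.ofHom ψ) (genericPoint (Spec (.of A'))) =
      genericPoint (Spec (.of A)) := by
  rw [genericPoint_eq_bot_of_affine, genericPoint_eq_bot_of_affine]
  exact PrimeSpectrum.ext ((RingHom.injective_iff_ker_eq_bot _).mp hψ)

/-- Base change of an abstract smoothing along an injective homomorphism of domains. -/
theorem IsAbstractSmoothing.of_injective {k A A' : Type u} [Field k] [CommRing A] [IsDomain A]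
    [Algebra k A] [CommRing A'] [IsDomain A'] [IsNoetherianRing A'] [Algebra k A']
    {ψ : A →ₐ[k] A'} (hψ : Function.Injective ψ) {ε : A →ₐ[k] k} {ε' : A' →ₐ[k] k}
    (hε : ε'.comp ψ = ε) {R Z Z' : Scheme.{u}} {f : R ⟶ Spec (.of k)} {π : Z ⟶ Spec (.of A)}
    {i : R ⟶ Z}
    (h : IsAbstractSmoothing f (Spec.map (CommRingCat.ofHom (algebraMap k A))) π
      (Spec.map (CommRingCat.ofHom ε.toRingHom)) i)
    {π' : Z' ⟶ Spec (.of A')} {g' : Z' ⟶ Z} {i' : R ⟶ Z'}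
    (hZ : IsPullback g' π' π (Spec.map (CommRingCat.ofHom ψ.toRingHom))) (hi : i' ≫ g' = i)
    (hi' : i' ≫ π' = f ≫ Spec.map (CommRingCat.ofHom ε'.toRingHom)) :
    IsAbstractSmoothing f (Spec.map (CommRingCat.ofHom (algebraMap k A'))) π'
      (Spec.map (CommRingCat.ofHom ε'.toRingHom)) i' := by
  refine h.of_isPullback inferInstance inferInstance hZ ?_ ?_ hi hi' (specMap_genericPoint _ hψ)
  · rw [← Spec.map_comp, ← CommRingCat.ofHom_comp]
    congr 2
    exact ψ.comp_algebraMap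
  · rw [← Spec.map_comp, ← CommRingCat.ofHom_comp, ← hε]
    rfl

/-- The morphism `g : R ⟶ X` of `k`-schemes extends to the total space of an abstract smoothing
of `R` over an integral affine base of finite type over `k`. -/
def MapSmoothable {k : Type u} [Field k] {R X : Scheme.{u}} (p : X ⟶ Spec (.of k)) (g : R ⟶ X) :
    Prop :=
  ∃ (A : Type u) (_ : CommRing A) (_ : IsDomain A) (_ : Algebra k A) (_ : Algebra.FiniteType k A)
    (ε : A →ₐ[k] k) (Z : Scheme.{u}) (π : Z ⟶ Spec (.of A)) (i : R ⟶ Z) (φ : Z ⟶ X),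
    IsAbstractSmoothing (g ≫ p) (Spec.map (CommRingCat.ofHom (algebraMap k A))) π
      (Spec.map (CommRingCat.ofHom ε.toRingHom)) i ∧
    i ≫ φ = g ∧ φ ≫ p = π ≫ Spec.map (CommRingCat.ofHom (algebraMap k A))

/-- A morphism from `R` to a smooth affine scheme extends to the total space of an abstract
smoothing of `R`, after a base change of the smoothing. -/
theorem mapSmoothable_of_formallySmooth {k A B S : Type u} [Field k] [CommRing A] [IsDomain A]
    [Algebra k A] [Algebra.FiniteType k A] {ε : A →ₐ[k] k} [CommRing B] [Algebra A B]
    [Module.Free A B] [Module.Finite A B] [CommRing S] [Algebra k S] [Algebra.FiniteType k S]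
    [Algebra.FormallySmooth k S] {R : Scheme.{u}} {f : R ⟶ Spec (.of k)} {i : R ⟶ Spec (.of B)}
    (h : IsAbstractSmoothing f (Spec.map (CommRingCat.ofHom (algebraMap k A)))
      (Spec.map (CommRingCat.ofHom (algebraMap A B))) (Spec.map (CommRingCat.ofHom ε.toRingHom)) i)
    (g : R ⟶ Spec (.of S)) (hg : g ≫ Spec.map (CommRingCat.ofHom (algebraMap k S)) = f) :
    MapSmoothable (Spec.map (CommRingCat.ofHom (algebraMap k S))) g := by
  have : IsNoetherianRing A := Algebra.FiniteType.isNoetherianRing k A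
  let _ : Algebra A k := ε.toRingHom.toAlgebra
  have : IsScalarTower k A k := .of_algebraMap_eq fun x ↦ (ε.commutes x).symm
  -- the special fibre
  have hk : IsPullback (Spec.map (CommRingCat.ofHom
      (Algebra.TensorProduct.includeRight : B →ₐ[A] k ⊗[A] B).toRingHom))
      (Spec.map (CommRingCat.ofHom (algebraMap k (k ⊗[A] B))))
      (Spec.map (CommRingCat.ofHom (algebraMap A B)))
      (Spec.map (CommRingCat.ofHom ε.toRingHom)) :=
    (isPullback_SpecMap_of_isPushout _ _ _ _ (CommRingCat.isPushout_tensorProduct A k B)).flip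
  let e : R ≅ Spec (.of (k ⊗[A] B)) := h.isPullback.isoIsPullback _ _ hk
  have he₁ : e.hom ≫ Spec.map (CommRingCat.ofHom
      (Algebra.TensorProduct.includeRight : B →ₐ[A] k ⊗[A] B).toRingHom) = i :=
    h.isPullback.isoIsPullback_hom_fst _ _ hk
  have he₂ : e.hom ≫ Spec.map (CommRingCat.ofHom (algebraMap k (k ⊗[A] B))) = f :=
    h.isPullback.isoIsPullback_hom_snd _ _ hk
  let γ : S →+* k ⊗[A] B := (Spec.preimage (e.inv ≫ g)).hom
  have hγ : Spec.map (CommRingCat.ofHom γ) = e.inv ≫ g := Spec.map_preimage _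
  let γ' : S →ₐ[k] k ⊗[A] B :=
    { γ with
      commutes' := fun x ↦ by
        have : CommRingCat.ofHom (algebraMap k S) ≫ CommRingCat.ofHom γ =
            CommRingCat.ofHom (algebraMap k (k ⊗[A] B)) := by
          apply Spec.map_injective
          rw [Spec.map_comp, hγ, Category.assoc, hg, ← he₂, Iso.inv_hom_id_assoc]
        exact congr($(this).hom x) }
  obtain ⟨A', _, _, _, _, _, v, w, hft, hinj, hv⟩ := exists_domain_of_formallySmooth γ'
  have : IsNoetherianRing A' := Algebra.FiniteType.isNoetherianRing k A'
  refine ⟨A', inferInstance, inferInstance, inferInstance, hft, w.restrictScalars k,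
    Spec (.of (A' ⊗[A] B)),
    Spec.map (CommRingCat.ofHom (algebraMap A' (A' ⊗[A] B))),
    e.hom ≫ Spec.map (CommRingCat.ofHom
      (Algebra.TensorProduct.map w (AlgHom.id A B)).toRingHom),
    Spec.map (CommRingCat.ofHom v.toRingHom), ?_, ?_, ?_⟩
  · rw [hg]
    refine h.of_injective (ψ := IsScalarTower.toAlgHom k A A')
      hinj ?_ (g' := Spec.map (CommRingCat.ofHom
        (Algebra.TensorProduct.includeRight : B →ₐ[A] A' ⊗[A] B).toRingHom)) ?_ ?_ ?_
    · ext x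
      exact w.commutes x
    · exact (isPullback_SpecMap_of_isPushout _ _ _ _
        (CommRingCat.isPushout_tensorProduct A A' B)).flip
    · rw [Category.assoc, ← Spec.map_comp, ← CommRingCat.ofHom_comp, ← he₁]
      congr 3
      ext x
      simp
    · rw [Category.assoc, ← Spec.map_comp, ← CommRingCat.ofHom_comp, ← he₂, Category.assoc,
        ← Spec.map_comp, ← CommRingCat.ofHom_comp]
      rfl
  · rw [Category.assoc, ← Spec.map_comp, ← CommRingCat.ofHom_comp, ← Iso.eq_inv_comp, ← hγ]
    congr 2
    ext x
    exact hv x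
  · rw [← Spec.map_comp, ← Spec.map_comp, ← CommRingCat.ofHom_comp, ← CommRingCat.ofHom_comp]
    congr 2
    exact v.comp_algebraMap

/-! ### Reduction to finite free smoothings over domains of finite type. -/

/-- Every abstract smoothing can be pulled back to a local Noetherian domain. -/
theorem IsAbstractSmoothing.exists_isLocalRing {k : Type u} [Field k] {R Z T : Scheme.{u}}
    {f : R ⟶ Spec (.of k)} {q : T ⟶ Spec (.of k)} {π : Z ⟶ T} {t : Spec (.of k) ⟶ T} {i : R ⟶ Z}
    (h : IsAbstractSmoothing f q π t i) :
    ∃ (A : Type u) (_ : CommRing A) (_ : IsDomain A) (_ : IsLocalRing A) (_ : Algebra k A)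
      (ε : A →ₐ[k] k) (B : Type u) (_ : CommRing B) (_ : Algebra A B) (_ : Module.Finite A B)
      (_ : Module.Free A B) (i' : R ⟶ Spec (.of B)),
      IsAbstractSmoothing f (Spec.map (CommRingCat.ofHom (algebraMap k A)))
        (Spec.map (CommRingCat.ofHom (algebraMap A B)))
        (Spec.map (CommRingCat.ofHom ε.toRingHom)) i' := by
  have := h.irreducible
  have := h.locallyNoetherian
  let x : T := t (IsLocalRing.closedPoint k)
  let O : CommRingCat.{u} := T.presheaf.stalk x
  let δ : O ⟶ .of k := Scheme.stalkClosedPointTo t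
  have hδ : Spec.map δ ≫ T.fromSpecStalk x = t := Scheme.Spec_stalkClosedPointTo_fromSpecStalk t
  have hloc : IsLocalHom δ.hom := Scheme.isLocalHom_stalkClosedPointTo' t
  -- `T` may be non-reduced, so the stalk need not be a domain; dividing by the prime `y` of the
  -- generic point makes it one.
  obtain ⟨y, hy⟩ : genericPoint T ∈ Set.range (T.fromSpecStalk x) := by
    rw [Scheme.range_fromSpecStalk]
    exact genericPoint_specializes x
  have := y.isPrime
  -- As `δ` is local with values in a field, it kills every non-unit; hence the marked point
  -- survives in the quotient.
  have hyδ : ∀ a ∈ y.asIdeal, δ.hom a = 0 := by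
    intro a ha
    by_contra h0
    exact y.isPrime.ne_top (Ideal.eq_top_of_isUnit_mem _ ha
      ((isUnit_map_iff δ.hom a).mp (isUnit_iff_ne_zero.mpr h0)))
  let A := O ⧸ y.asIdeal
  have : IsNoetherianRing O := inferInstanceAs (IsNoetherianRing (T.presheaf.stalk x))
  have : IsLocalRing O := inferInstanceAs (IsLocalRing (T.presheaf.stalk x))
  have : IsLocalRing A := .of_surjective' (Ideal.Quotient.mk y.asIdeal) Ideal.Quotient.mk_surjective
  let g : Spec (.of A) ⟶ T := Spec.map (CommRingCat.ofHom (Ideal.Quotient.mk y.asIdeal)) ≫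
    T.fromSpecStalk x
  let α : CommRingCat.of k ⟶ .of A := Spec.preimage (g ≫ q)
  have hα : Spec.map α = g ≫ q := Spec.map_preimage _
  let _ : Algebra k A := α.hom.toAlgebra
  let ε₀ : A →+* k := Ideal.Quotient.lift y.asIdeal δ.hom hyδ
  have hε₀ : Spec.map (CommRingCat.ofHom ε₀) ≫ g = t := by
    rw [← hδ, ← Category.assoc, ← Spec.map_comp, ← CommRingCat.ofHom_comp]
    rfl
  let ε : A →ₐ[k] k :=
    { ε₀ with
      commutes' := fun c ↦ by
        have : α ≫ CommRingCat.ofHom ε₀ = 𝟙 _ := by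
          apply Spec.map_injective
          rw [Spec.map_comp, hα, ← Category.assoc, hε₀, h.rational, Spec.map_id]
        exact congr($(this).hom c) }
  have := h.finite
  have : IsAffine (pullback π g) := isAffine_of_isAffineHom (pullback.snd π g)
  let B : CommRingCat.{u} := Γ(pullback π g, ⊤)
  let β : CommRingCat.of A ⟶ B := Spec.preimage ((pullback π g).isoSpec.inv ≫ pullback.snd π g)
  have hβ : Spec.map β = (pullback π g).isoSpec.inv ≫ pullback.snd π g := Spec.map_preimage _
  let _ : Algebra A B := β.hom.toAlgebra
  have hp : IsPullback ((pullback π g).isoSpec.inv ≫ pullback.fst π g) (Spec.map β) π g :=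
    .of_iso_pullback ⟨by rw [hβ, Category.assoc, pullback.condition, Category.assoc]⟩
      (pullback π g).isoSpec.symm (by simp) (by simp [hβ])
  have hs : IsAbstractSmoothing f (Spec.map (CommRingCat.ofHom (algebraMap k A)))
        (Spec.map (CommRingCat.ofHom (algebraMap A B)))
        (Spec.map (CommRingCat.ofHom ε.toRingHom))
        (hp.lift i (f ≫ Spec.map (CommRingCat.ofHom ε₀)) (by
          rw [h.isPullback.w, Category.assoc, hε₀])) := by
    refine h.of_isPullback inferInstance inferInstance hp hα.symm hε₀ (hp.lift_fst _ _ _)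
      (hp.lift_snd _ _ _) ?_
    rw [genericPoint_eq_bot_of_affine, ← hy]
    exact congrArg (T.fromSpecStalk x) (PrimeSpectrum.ext y.asIdeal.mk_ker)
  have : Module.Finite A B := (IsFinite.SpecMap_iff _).mp hs.finite
  have : Module.Flat A B := Flat.SpecMap_iff.mp hs.flat
  have : Module.Free A B := Module.free_of_flat_of_isLocalRing
  exact ⟨A, inferInstance, inferInstance, inferInstance, inferInstance, ε, B, inferInstance,
    inferInstance, inferInstance, inferInstance, _, hs⟩

/-- A finite free algebra over a `k`-algebra is defined over a subalgebra of finite type. -/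
theorem exists_subalgebra_isPushout (k : Type*) {A B : Type*} [CommRing k] [CommRing A]
    [Algebra k A] [CommRing B] [Algebra A B] [Module.Finite A B] [Module.Free A B] :
    ∃ (A₀ : Subalgebra k A) (B₀ : Subalgebra A₀ B), Algebra.FiniteType k A₀ ∧
      Module.Finite A₀ B₀ ∧ Module.Free A₀ B₀ ∧ Algebra.IsPushout A₀ A B₀ B := by
  let b := Module.Free.chooseBasis A B
  let ι := Module.Free.ChooseBasisIndex A B
  -- The structure constants of `B` and the coordinates of `1`: over the subalgebra they generate,
  -- the span of the basis is already a ring.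
  let s : Set A := (Set.range fun x : ι × ι × ι ↦ b.repr (b x.1 * b x.2.1) x.2.2) ∪
    Set.range (b.repr 1)
  let A₀ : Subalgebra k A := Algebra.adjoin k s
  have hs (x : A) (hx : x ∈ s) : x ∈ A₀ := Algebra.subset_adjoin hx
  have hfin : s.Finite := (Set.finite_range _).union (Set.finite_range _)
  have hmem (y : B) (hy : ∀ l, b.repr y l ∈ A₀) : y ∈ Submodule.span A₀ (Set.range b) := by
    rw [← b.sum_repr y]
    refine Submodule.sum_mem _ fun l _ ↦ ?_
    exact Submodule.smul_mem _ (⟨_, hy l⟩ : A₀) (Submodule.subset_span ⟨l, rfl⟩)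
  let B₀ : Subalgebra A₀ B :=
    (Submodule.span A₀ (Set.range b)).toSubalgebra
      (hmem 1 fun l ↦ hs _ (Or.inr ⟨l, rfl⟩)) (by
        intro x y hx hy
        induction hx, hy using Submodule.span_induction₂ with
        | mem_mem x y hx hy =>
          obtain ⟨i, rfl⟩ := hx
          obtain ⟨j, rfl⟩ := hy
          exact hmem _ fun l ↦ hs _ (Or.inl ⟨(i, j, l), rfl⟩)
        | zero_left => simp
        | zero_right => simp
        | add_left x y z _ _ _ hx hy => rw [add_mul]; exact add_mem hx hy
        | add_right x y z _ _ _ hx hy => rw [mul_add]; exact add_mem hx hy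
        | smul_left r x y _ _ h => rw [smul_mul_assoc]; exact Submodule.smul_mem _ _ h
        | smul_right r x y _ _ h => rw [mul_smul_comm]; exact Submodule.smul_mem _ _ h)
  let b₀ : Module.Basis ι A₀ B₀ :=
    Module.Basis.span (R := A₀) (v := b) (b.linearIndependent.restrict_scalars (by
      intro x y h
      simpa [Subalgebra.smul_def] using h))
  have hb₀ (l : ι) : (b₀ l : B) = b l :=
    congrArg Subtype.val (Module.Basis.span_apply _ l)
  refine ⟨A₀, B₀, ?_, .of_basis b₀, .of_basis b₀, ⟨?_⟩⟩
  · exact (Subalgebra.fg_iff_finiteType _).mp ⟨hfin.toFinset, by simp [A₀]⟩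
  · let e := (Algebra.TensorProduct.basis A b₀).equiv b (Equiv.refl ι)
    have he : e.toLinearMap.restrictScalars A₀ ∘ₗ TensorProduct.mk A₀ A B₀ 1 =
        (IsScalarTower.toAlgHom A₀ B₀ B).toLinearMap := by
      refine b₀.ext fun l ↦ ?_
      have : e (Algebra.TensorProduct.basis A b₀ l) = b l := Module.Basis.equiv_apply _ _ _ _
      rw [Algebra.TensorProduct.basis_apply] at this
      exact this.trans (hb₀ l).symm
    exact IsBaseChange.of_equiv e fun x ↦ LinearMap.congr_fun he x

/-- Every abstract smoothing over a domain descends to a domain of finite type. -/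
theorem IsAbstractSmoothing.exists_finiteType {k A B : Type u} [Field k] [CommRing A] [IsDomain A]
    [Algebra k A] {ε : A →ₐ[k] k} [CommRing B] [Algebra A B] [Module.Finite A B] [Module.Free A B]
    {R : Scheme.{u}} {f : R ⟶ Spec (.of k)} {i : R ⟶ Spec (.of B)}
    (h : IsAbstractSmoothing f (Spec.map (CommRingCat.ofHom (algebraMap k A)))
        (Spec.map (CommRingCat.ofHom (algebraMap A B)))
        (Spec.map (CommRingCat.ofHom ε.toRingHom)) i) :
    ∃ (A₀ : Type u) (_ : CommRing A₀) (_ : IsDomain A₀) (_ : Algebra k A₀)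
      (_ : Algebra.FiniteType k A₀) (ε₀ : A₀ →ₐ[k] k) (B₀ : Type u) (_ : CommRing B₀)
      (_ : Algebra A₀ B₀) (_ : Module.Finite A₀ B₀) (_ : Module.Free A₀ B₀)
      (i₀ : R ⟶ Spec (.of B₀)),
      IsAbstractSmoothing f (Spec.map (CommRingCat.ofHom (algebraMap k A₀)))
        (Spec.map (CommRingCat.ofHom (algebraMap A₀ B₀)))
        (Spec.map (CommRingCat.ofHom ε₀.toRingHom)) i₀ := by
  obtain ⟨A₀, B₀, hft, hfin, hfree, hpush⟩ := exists_subalgebra_isPushout k (A := A) (B := B)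
  have hp : IsPullback (Spec.map (CommRingCat.ofHom (algebraMap B₀ B)))
      (Spec.map (CommRingCat.ofHom (algebraMap A B)))
      (Spec.map (CommRingCat.ofHom (algebraMap A₀ B₀)))
      (Spec.map (CommRingCat.ofHom (algebraMap A₀ A))) :=
    (isPullback_SpecMap_of_isPushout _ _ _ _ (CommRingCat.isPushout_of_isPushout A₀ A B₀ B)).flip
  have : IsNoetherianRing A₀ := Algebra.FiniteType.isNoetherianRing k A₀
  have hflat : Flat (Spec.map (CommRingCat.ofHom (algebraMap A₀ B₀))) :=
    Flat.SpecMap_iff.mpr (RingHom.flat_algebraMap_iff.mpr inferInstance)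
  refine ⟨A₀, inferInstance, inferInstance, inferInstance, hft, ε.comp A₀.val, B₀, inferInstance,
    inferInstance, hfin, hfree, i ≫ Spec.map (CommRingCat.ofHom (algebraMap B₀ B)), inferInstance,
    inferInstance, ?_, (IsFinite.SpecMap_iff _).mpr (RingHom.finite_algebraMap.mpr hfin), hflat,
    ?_, ?_⟩
  · rw [← Spec.map_comp, ← CommRingCat.ofHom_comp, ← Spec.map_id]
    congr 1
    ext x
    exact (ε.comp A₀.val).commutes x
  · convert h.isPullback.paste_horiz hp using 1
    rw [← Spec.map_comp, ← CommRingCat.ofHom_comp]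
    rfl
  · have hg := specMap_genericPoint (algebraMap A₀ A) Subtype.val_injective
    rw [← hg]
    -- The two generic fibres differ by an extension of residue fields, which is faithfully flat and
    -- quasi-compact, so smoothness descends.
    have hc := isPullback_fiberToSpecResidueField_of_isPullback hp (genericPoint (Spec (.of A)))
    let := (((Spec.map (CommRingCat.ofHom (algebraMap A₀ A))).residueFieldMap
      (genericPoint (Spec (.of A)))).hom).toAlgebra
    have hsurj : Surjective (Spec.map ((Spec.map
        (CommRingCat.ofHom (algebraMap A₀ A))).residueFieldMap (genericPoint (Spec (.of A))))) :=
      ⟨fun x ↦ ⟨IsLocalRing.closedPoint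
        ((Spec (.of A)).residueField (genericPoint (Spec (.of A)))),
        Subsingleton.elim (α := PrimeSpectrum _) _ _⟩⟩
    have hflat : Flat (Spec.map ((Spec.map
        (CommRingCat.ofHom (algebraMap A₀ A))).residueFieldMap (genericPoint (Spec (.of A))))) :=
      Flat.SpecMap_iff.mpr (RingHom.flat_algebraMap_iff.mpr inferInstance)
    exact MorphismProperty.of_isPullback_of_descendsAlong (P := @Smooth.{u})
      (Q := @Surjective ⊓ @Flat ⊓ @QuasiCompact) hc.flip
      ⟨⟨hsurj, hflat⟩, inferInstance⟩ h.smooth_generic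

/-- An abstractly smoothable scheme has an abstract smoothing which is free over a domain of
finite type. -/
theorem AbstractlySmoothable.exists_finiteType {k : Type u} [Field k] {R : Scheme.{u}}
    {f : R ⟶ Spec (.of k)} (h : AbstractlySmoothable f) :
    ∃ (A : Type u) (_ : CommRing A) (_ : IsDomain A) (_ : Algebra k A)
      (_ : Algebra.FiniteType k A) (ε : A →ₐ[k] k) (B : Type u) (_ : CommRing B)
      (_ : Algebra A B) (_ : Module.Finite A B) (_ : Module.Free A B)
      (i : R ⟶ Spec (.of B)),
      IsAbstractSmoothing f (Spec.map (CommRingCat.ofHom (algebraMap k A)))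
        (Spec.map (CommRingCat.ofHom (algebraMap A B)))
        (Spec.map (CommRingCat.ofHom ε.toRingHom)) i := by
  obtain ⟨T, Z, q, π, t, i, h⟩ := h
  obtain ⟨A, _, _, _, _, ε, B, _, _, _, _, i', h'⟩ := h.exists_isLocalRing
  exact h'.exists_finiteType

theorem AbstractlySmoothable.mapSmoothable {k S : Type u} [Field k] {R : Scheme.{u}}
    {f : R ⟶ Spec (.of k)} (h : AbstractlySmoothable f) [CommRing S] [Algebra k S]
    [Algebra.FiniteType k S] [Algebra.FormallySmooth k S] (g : R ⟶ Spec (.of S))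
    (hg : g ≫ Spec.map (CommRingCat.ofHom (algebraMap k S)) = f) :
    MapSmoothable (Spec.map (CommRingCat.ofHom (algebraMap k S))) g := by
  obtain ⟨A, _, _, _, _, ε, B, _, _, _, _, i, h⟩ := h.exists_finiteType
  exact mapSmoothable_of_formallySmooth h g hg

/-! ### Common bases and disjoint unions of extended morphisms. -/

/-- Two pointed integral affine schemes of finite type over `k` are dominated by a third one. -/
theorem exists_domain_of_algHom {k A₁ A₂ : Type u} [Field k] [CommRing A₁] [IsDomain A₁]
    [Algebra k A₁] [Algebra.FiniteType k A₁] [CommRing A₂] [IsDomain A₂] [Algebra k A₂]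
    [Algebra.FiniteType k A₂] (ε₁ : A₁ →ₐ[k] k) (ε₂ : A₂ →ₐ[k] k) :
    ∃ (A : Type u) (_ : CommRing A) (_ : IsDomain A) (_ : Algebra k A) (_ : Algebra.FiniteType k A)
      (ε : A →ₐ[k] k) (ψ₁ : A₁ →ₐ[k] A) (ψ₂ : A₂ →ₐ[k] A), Function.Injective ψ₁ ∧
      Function.Injective ψ₂ ∧ ε.comp ψ₁ = ε₁ ∧ ε.comp ψ₂ = ε₂ := by
  let C := A₁ ⊗[k] A₂
  let ε₀ : C →ₐ[k] k := Algebra.TensorProduct.lift ε₁ ε₂ fun _ _ ↦ mul_comm _ _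
  have : (RingHom.ker ε₀).IsPrime := RingHom.ker_isPrime _
  -- A component of the product through the point `(ε₁, ε₂)`; it dominates both factors because `C`
  -- is flat over each of them.
  obtain ⟨P, hP, hPε⟩ := Ideal.exists_minimalPrimes_le (bot_le (a := RingHom.ker ε₀))
  have : P.IsPrime := hP.1.1
  have : Algebra.FiniteType k C :=
    Algebra.FiniteType.trans (S := A₁) inferInstance (inferInstanceAs (Algebra.FiniteType A₁ C))
  refine ⟨C ⧸ P, inferInstance, inferInstance, inferInstance,
    .of_surjective (Ideal.Quotient.mkₐ k P) (Ideal.Quotient.mkₐ_surjective k P),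
    Ideal.Quotient.liftₐ P ε₀ fun a ha ↦ hPε ha,
    (Ideal.Quotient.mkₐ k P).comp Algebra.TensorProduct.includeLeft,
    (Ideal.Quotient.mkₐ k P).comp Algebra.TensorProduct.includeRight, ?_, ?_, ?_, ?_⟩
  · exact algebraMap_quotient_injective_of_mem_minimalPrimes (A := A₁) hP
  · let _ : Algebra A₂ C := Algebra.TensorProduct.rightAlgebra
    have : Module.Flat A₂ C := Module.Flat.isBaseChange k A₂ A₁ C
      (f := (IsScalarTower.toAlgHom k A₁ C).toLinearMap) (Algebra.IsPushout.out)
    exact algebraMap_quotient_injective_of_mem_minimalPrimes (A := A₂) hP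
  · ext x
    exact (Algebra.TensorProduct.lift_tmul ε₁ ε₂ (fun _ _ ↦ mul_comm _ _) x 1).trans (by simp)
  · ext x
    exact (Algebra.TensorProduct.lift_tmul ε₁ ε₂ (fun _ _ ↦ mul_comm _ _) 1 x).trans (by simp)

/-- A morphism from a disjoint union extends to a smoothing as soon as its restrictions to both
parts do. -/
theorem MapSmoothable.of_isColimit_binaryCofan {k : Type u} [Field k] {R R₁ R₂ X : Scheme.{u}}
    {p : X ⟶ Spec (.of k)} {g : R ⟶ X} {r₁ : R₁ ⟶ R} {r₂ : R₂ ⟶ R}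
    (hR : IsColimit (BinaryCofan.mk r₁ r₂)) (h₁ : MapSmoothable p (r₁ ≫ g))
    (h₂ : MapSmoothable p (r₂ ≫ g)) : MapSmoothable p g := by
  obtain ⟨A₁, _, _, _, _, ε₁, Z₁, π₁, i₁, φ₁, h₁, hi₁, hφ₁⟩ := h₁
  obtain ⟨A₂, _, _, _, _, ε₂, Z₂, π₂, i₂, φ₂, h₂, hi₂, hφ₂⟩ := h₂
  obtain ⟨A, _, _, _, _, ε, ψ₁, ψ₂, hψ₁, hψ₂, hε₁, hε₂⟩ := exists_domain_of_algHom ε₁ ε₂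
  have : IsNoetherianRing A := Algebra.FiniteType.isNoetherianRing k A
  rw [Category.assoc] at h₁ h₂
  let q := Spec.map (CommRingCat.ofHom ε.toRingHom)
  let s₁ := Spec.map (CommRingCat.ofHom ψ₁.toRingHom)
  let s₂ := Spec.map (CommRingCat.ofHom ψ₂.toRingHom)
  have hq₁ : q ≫ s₁ = Spec.map (CommRingCat.ofHom ε₁.toRingHom) := by
    rw [← Spec.map_comp, ← CommRingCat.ofHom_comp, ← hε₁]
    rfl
  have hq₂ : q ≫ s₂ = Spec.map (CommRingCat.ofHom ε₂.toRingHom) := by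
    rw [← Spec.map_comp, ← CommRingCat.ofHom_comp, ← hε₂]
    rfl
  have hs₁ : s₁ ≫ Spec.map (CommRingCat.ofHom (algebraMap k A₁)) =
      Spec.map (CommRingCat.ofHom (algebraMap k A)) := by
    rw [← Spec.map_comp, ← CommRingCat.ofHom_comp]
    congr 2
    exact ψ₁.comp_algebraMap
  have hs₂ : s₂ ≫ Spec.map (CommRingCat.ofHom (algebraMap k A₂)) =
      Spec.map (CommRingCat.ofHom (algebraMap k A)) := by
    rw [← Spec.map_comp, ← CommRingCat.ofHom_comp]
    congr 2
    exact ψ₂.comp_algebraMap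
  let j₁ : R₁ ⟶ pullback π₁ s₁ := pullback.lift i₁ (r₁ ≫ (g ≫ p) ≫ q) (by
    rw [h₁.isPullback.w, ← hq₁]
    simp only [Category.assoc])
  let j₂ : R₂ ⟶ pullback π₂ s₂ := pullback.lift i₂ (r₂ ≫ (g ≫ p) ≫ q) (by
    rw [h₂.isPullback.w, ← hq₂]
    simp only [Category.assoc])
  have h₁' : IsAbstractSmoothing (r₁ ≫ g ≫ p) (Spec.map (CommRingCat.ofHom (algebraMap k A)))
      (pullback.snd π₁ s₁) q j₁ :=
    h₁.of_injective hψ₁ hε₁ (.of_hasPullback _ _) (pullback.lift_fst _ _ _) (by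
      simp only [j₁, pullback.lift_snd, Category.assoc, q])
  have h₂' : IsAbstractSmoothing (r₂ ≫ g ≫ p) (Spec.map (CommRingCat.ofHom (algebraMap k A)))
      (pullback.snd π₂ s₂) q j₂ :=
    h₂.of_injective hψ₂ hε₂ (.of_hasPullback _ _) (pullback.lift_fst _ _ _) (by
      simp only [j₂, pullback.lift_snd, Category.assoc, q])
  let i : R ⟶ pullback π₁ s₁ ⨿ pullback π₂ s₂ :=
    hR.desc (BinaryCofan.mk (j₁ ≫ coprod.inl) (j₂ ≫ coprod.inr))
  have hj₁ : r₁ ≫ i = j₁ ≫ coprod.inl := hR.fac _ ⟨.left⟩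
  have hj₂ : r₂ ≫ i = j₂ ≫ coprod.inr := hR.fac _ ⟨.right⟩
  refine ⟨A, inferInstance, inferInstance, inferInstance, inferInstance, ε, _, _, i,
    coprod.desc (pullback.fst π₁ s₁ ≫ φ₁) (pullback.fst π₂ s₂ ≫ φ₂),
    h₁'.coprod h₂' hR hj₁ hj₂, BinaryCofan.IsColimit.hom_ext hR ?_ ?_, ?_⟩
  · change r₁ ≫ _ = r₁ ≫ _
    rw [← Category.assoc, hj₁, Category.assoc, coprod.inl_desc, pullback.lift_fst_assoc, hi₁]
  · change r₂ ≫ _ = r₂ ≫ _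
    rw [← Category.assoc, hj₂, Category.assoc, coprod.inr_desc, pullback.lift_fst_assoc, hi₂]
  · apply coprod.hom_ext
    · rw [coprod.inl_desc_assoc, coprod.inl_desc_assoc, Category.assoc, hφ₁, ← hs₁,
        pullback.condition_assoc]
    · rw [coprod.inr_desc_assoc, coprod.inr_desc_assoc, Category.assoc, hφ₂, ← hs₂,
        pullback.condition_assoc]

/-- A morphism from the empty scheme extends to a smoothing. -/
theorem MapSmoothable.of_isEmpty {k : Type u} [Field k] {R X : Scheme.{u}} [IsEmpty R]
    (p : X ⟶ Spec (.of k)) (g : R ⟶ X) : MapSmoothable p g := by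
  have hid : Spec.map (CommRingCat.ofHom (AlgHom.id k k).toRingHom) = 𝟙 _ := Spec.map_id _
  have hid' : Spec.map (CommRingCat.ofHom (algebraMap k k)) = 𝟙 _ := Spec.map_id _
  -- The constant family over `Spec k` works: the empty scheme is open and closed in `Spec k`, hence
  -- smooth and finite over it.
  have : IsOpenImmersion (g ≫ p) := isOpenImmersion_of_isEmpty _
  have : IsClosedImmersion (g ≫ p) := by
    refine IsClosedImmersion.of_isPreimmersion _ ?_
    rw [Set.range_eq_empty]
    exact isClosed_empty
  have hs : Smooth (g ≫ p) := inferInstance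
  refine ⟨k, inferInstance, inferInstance, inferInstance, inferInstance, AlgHom.id k k, R, g ≫ p,
    𝟙 R, g, ⟨inferInstance, inferInstance, ?_, inferInstance, inferInstance, ?_, ?_⟩, ?_, ?_⟩
  · rw [hid, hid', Category.comp_id]
  · rw [hid]
    exact IsPullback.of_id_snd.flip
  · exact MorphismProperty.of_isPullback (.of_hasPullback _ _) hs
  · rw [Category.id_comp]
  · rw [hid', Category.comp_id]

theorem MapSmoothable.comp {k : Type u} [Field k] {R X Y : Scheme.{u}}
    {p : X ⟶ Spec (.of k)} {a : Y ⟶ X} {g : R ⟶ Y} (h : MapSmoothable (a ≫ p) g) :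
    MapSmoothable p (g ≫ a) := by
  obtain ⟨A, _, _, _, _, ε, Z, π, i, φ, h, hi, hφ⟩ := h
  refine ⟨A, inferInstance, inferInstance, inferInstance, inferInstance, ε, Z, π, i, φ ≫ a, ?_, ?_,
    ?_⟩
  · rwa [Category.assoc]
  · rw [← Category.assoc, hi]
  · rw [Category.assoc, hφ]

/-! ### From extended morphisms to closed embeddings. -/

/-- By Nakayama `d` is surjective, and a surjective idempotent is the identity. -/
theorem eq_id_of_sub_mem_smul {A F : Type*} [CommRing A] [IsLocalRing A] [AddCommGroup F]
    [Module A F] [Module.Finite A F] {d : F →ₗ[A] F} (hd : ∀ x, d (d x) = d x)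
    (h : ∀ x, x - d x ∈ IsLocalRing.maximalIdeal A • (⊤ : Submodule A F)) (x : F) : d x = x := by
  have : (⊤ : Submodule A F) ≤ LinearMap.range d := by
    refine Submodule.le_of_le_smul_of_le_jacobson_bot (I := IsLocalRing.maximalIdeal A)
      Module.Finite.fg_top (IsLocalRing.maximalIdeal_le_jacobson _) fun y _ ↦ ?_
    rw [← add_sub_cancel (d y) y]
    exact Submodule.add_mem_sup ⟨y, rfl⟩ (h y)
  obtain ⟨y, rfl⟩ := this (Submodule.mem_top (x := x))
  exact hd y

/-- A morphism from a finite scheme over a local ring to a separated scheme is a closed immersion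
if its restriction to the closed fibre is a monomorphism. -/
theorem isClosedImmersion_of_mono {A k : Type u} [CommRing A] [IsLocalRing A] [Field k]
    {ε : A →+* k} (hε : Function.Surjective ε) {R Y Z : Scheme.{u}} {f : R ⟶ Spec (.of k)}
    {i : R ⟶ Z} {j : Z ⟶ Y} {s : Y ⟶ Spec (.of A)} [IsSeparated s] [IsFinite (j ≫ s)]
    (h : IsPullback i f (j ≫ s) (Spec.map (CommRingCat.ofHom ε))) [Mono (i ≫ j)] :
    IsClosedImmersion j := by
  have hj : IsFinite j := IsFinite.of_comp j s
  refine (IsClosedImmersion.iff_isFinite_and_mono j).mpr ⟨hj, ?_⟩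
  let W := pullback j j
  have : IsFinite (pullback.fst j j ≫ j ≫ s) := inferInstance
  have : IsAffine W := isAffine_of_isAffineHom (pullback.fst j j ≫ j ≫ s)
  let F : CommRingCat.{u} := Γ(W, ⊤)
  let α : CommRingCat.of A ⟶ F := Spec.preimage (W.isoSpec.inv ≫ pullback.fst j j ≫ j ≫ s)
  have hα : Spec.map α = W.isoSpec.inv ≫ pullback.fst j j ≫ j ≫ s := Spec.map_preimage _
  let _ : Algebra A F := α.hom.toAlgebra
  have : Module.Finite A F := (IsFinite.SpecMap_iff α).mp (hα ▸ inferInstance)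
  -- The first projection followed by the diagonal, an idempotent. If it is the identity, the two
  -- projections agree, that is, `j` is a monomorphism.
  let d : W ⟶ W := pullback.fst j j ≫ pullback.diagonal j
  have hd₁ : d ≫ pullback.fst j j = pullback.fst j j := by
    rw [Category.assoc, pullback.diagonal_fst, Category.comp_id]
  have hd₂ : d ≫ pullback.snd j j = pullback.fst j j := by
    rw [Category.assoc, pullback.diagonal_snd, Category.comp_id]
  have hdd : d ≫ d = d := by
    rw [← Category.assoc, hd₁]
  let δ : F ⟶ F := d.appTop
  have hδ : Spec.map δ ≫ W.isoSpec.inv = W.isoSpec.inv ≫ d := Scheme.isoSpec_inv_naturality d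
  have hδδ : δ ≫ δ = δ := by
    change d.appTop ≫ d.appTop = d.appTop
    rw [← Scheme.Hom.comp_appTop, hdd]
  have hαδ : α ≫ δ = α := by
    apply Spec.map_injective
    rw [Spec.map_comp, hα, ← Category.assoc, hδ, Category.assoc, ← Category.assoc d, hd₁]
  let δ' : F →ₗ[A] F :=
    { δ.hom with
      map_smul' := fun a x ↦ by
        rw [Algebra.smul_def, Algebra.smul_def]
        refine (map_mul δ.hom _ _).trans ?_
        congr 1
        exact congr($(hαδ).hom a) }
  let m := IsLocalRing.maximalIdeal A
  have hm : RingHom.ker ε = m :=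
    IsLocalRing.eq_maximalIdeal (RingHom.ker_isMaximal_of_surjective ε hε)
  let I : Ideal F := m.map (algebraMap A F)
  let c₀ : F ⟶ .of (F ⧸ I) := CommRingCat.ofHom (Ideal.Quotient.mk I)
  let c : Spec (.of (F ⧸ I)) ⟶ W := Spec.map c₀ ≫ W.isoSpec.inv
  have hker : RingHom.ker ε ≤ RingHom.ker ((Ideal.Quotient.mk I).comp α.hom) := by
    intro a ha
    rw [hm] at ha
    exact Ideal.Quotient.eq_zero_iff_mem.mpr (Ideal.mem_map_of_mem _ ha)
  let σ : k →+* F ⧸ I :=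
    ε.liftOfRightInverse _ (Function.rightInverse_surjInv hε) ⟨_, hker⟩
  have hσ : Spec.map (CommRingCat.ofHom σ) ≫ Spec.map (CommRingCat.ofHom ε) =
      c ≫ pullback.fst j j ≫ j ≫ s := by
    rw [Category.assoc, ← hα, ← Spec.map_comp, ← Spec.map_comp, ← CommRingCat.ofHom_comp]
    congr 1
    ext a
    exact RingHom.liftOfRightInverse_comp_apply ε _ (Function.rightInverse_surjInv hε) ⟨_, hker⟩ a
  -- On the closed fibre both projections factor through `R`, where `i ≫ j` is a monomorphism.
  have hcc : c ≫ pullback.fst j j = c ≫ pullback.snd j j := by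
    let u₁ := h.lift (c ≫ pullback.fst j j) (Spec.map (CommRingCat.ofHom σ))
      (by rw [hσ, Category.assoc])
    let u₂ := h.lift (c ≫ pullback.snd j j) (Spec.map (CommRingCat.ofHom σ))
      (by rw [hσ, Category.assoc, pullback.condition_assoc])
    have hu : u₁ = u₂ := by
      rw [← cancel_mono (i ≫ j), h.lift_fst_assoc, h.lift_fst_assoc]
      simp only [Category.assoc, pullback.condition]
    rw [← h.lift_fst (c ≫ pullback.fst j j) _ (by rw [hσ, Category.assoc]),
      ← h.lift_fst (c ≫ pullback.snd j j) (Spec.map (CommRingCat.ofHom σ))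
        (by rw [hσ, Category.assoc, pullback.condition_assoc])]
    exact congr($hu ≫ i)
  have hcd : c ≫ d = c := by
    apply pullback.hom_ext
    · rw [Category.assoc, hd₁]
    · rw [Category.assoc, hd₂, hcc]
  have hδc : δ ≫ c₀ = c₀ := by
    apply Spec.map_injective
    rw [Spec.map_comp, ← cancel_mono W.isoSpec.inv, Category.assoc, hδ, ← Category.assoc]
    exact hcd
  -- `δ` is the identity modulo the maximal ideal, and `F` is a finite `A`-module.
  have hδ1 : δ = 𝟙 F := by
    ext x
    refine eq_id_of_sub_mem_smul (A := A) (d := δ') (fun x ↦ congr($(hδδ).hom x)) (fun x ↦ ?_) x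
    rw [Ideal.smul_top_eq_map]
    exact Ideal.Quotient.eq.mp congr($(hδc).hom x).symm
  have hd : d = 𝟙 W := by
    rw [← cancel_epi W.isoSpec.inv, ← hδ, hδ1, Spec.map_id, Category.id_comp, Category.comp_id]
  have hfs : pullback.fst j j = pullback.snd j j := by
    rw [← hd₂, hd, Category.id_comp]
  refine ⟨fun a b hab ↦ ?_⟩
  rw [← pullback.lift_fst a b hab, hfs, pullback.lift_snd]

/-- A closed subscheme is embedded smoothable if its inclusion extends to an abstract smoothing. -/
theorem MapSmoothable.embeddedSmoothable {k : Type u} [Field k] {R X : Scheme.{u}}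
    {p : X ⟶ Spec (.of k)} [IsSeparated p] {ι : R ⟶ X} [IsClosedImmersion ι]
    (h : MapSmoothable p ι) : EmbeddedSmoothable p ι := by
  obtain ⟨A, _, _, _, _, ε, Z, π, i, φ, h, hi, hφ⟩ := h
  have : IsNoetherianRing A := Algebra.FiniteType.isNoetherianRing k A
  have : (RingHom.ker ε).IsPrime := RingHom.ker_isPrime _
  -- Localizing at the marked point makes it the closed point of a local base, so that being an
  -- embedding can be tested on `R`.
  let A' := Localization.AtPrime (RingHom.ker ε)
  have : IsDomain A' := IsLocalization.isDomain_localization (Ideal.primeCompl_le_nonZeroDivisors _)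
  have : IsNoetherianRing A' := IsLocalization.isNoetherianRing (RingHom.ker ε).primeCompl _ ‹_›
  let ψ : A →ₐ[k] A' := IsScalarTower.toAlgHom k A A'
  have hψ : Function.Injective ψ :=
    IsLocalization.injective A' (Ideal.primeCompl_le_nonZeroDivisors (RingHom.ker ε))
  let ε' : A' →ₐ[k] k := IsLocalization.liftAlgHom (M := (RingHom.ker ε).primeCompl) (f := ε)
    fun y ↦ isUnit_iff_ne_zero.mpr y.2
  have hε : ε'.comp ψ = ε := by
    ext x
    exact IsLocalization.lift_eq _ x
  have hε' : Function.Surjective ε'.toRingHom := fun x ↦ ⟨algebraMap k A' x, ε'.commutes x⟩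
  let q := Spec.map (CommRingCat.ofHom (algebraMap k A'))
  let t := Spec.map (CommRingCat.ofHom ε'.toRingHom)
  let s := Spec.map (CommRingCat.ofHom ψ.toRingHom)
  have hts : t ≫ s = Spec.map (CommRingCat.ofHom ε.toRingHom) := by
    rw [← Spec.map_comp, ← CommRingCat.ofHom_comp]
    congr 2
    exact congr($(hε).toRingHom)
  have hs : s ≫ Spec.map (CommRingCat.ofHom (algebraMap k A)) = q := by
    rw [← Spec.map_comp, ← CommRingCat.ofHom_comp]
    congr 2
  let i' : R ⟶ pullback π s := pullback.lift i ((ι ≫ p) ≫ t) (by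
    rw [h.isPullback.w, ← hts, Category.assoc (ι ≫ p)])
  have h' : IsAbstractSmoothing (ι ≫ p) q (pullback.snd π s) t i' :=
    h.of_injective hψ hε (.of_hasPullback _ _) (pullback.lift_fst _ _ _) (pullback.lift_snd _ _ _)
  let j : pullback π s ⟶ pullback p q := pullback.lift (pullback.fst π s ≫ φ) (pullback.snd π s) (by
    rw [Category.assoc, hφ, pullback.condition_assoc, hs])
  have hj : j ≫ pullback.snd p q = pullback.snd π s := pullback.lift_snd _ _ _
  have hij : i' ≫ j ≫ pullback.fst p q = ι := by
    rw [pullback.lift_fst, pullback.lift_fst_assoc, hi]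
  rw [← hj] at h'
  have : IsFinite (j ≫ pullback.snd p q) := h'.finite
  have : Mono (i' ≫ j) := by
    have : Mono ((i' ≫ j) ≫ pullback.fst p q) := by
      rw [Category.assoc, hij]
      infer_instance
    exact mono_of_mono _ (pullback.fst p q)
  exact ⟨_, _, q, j, t, i', isClosedImmersion_of_mono hε' h'.isPullback, h', hij⟩

/-! ### Clopen subschemes, and assembly from points. -/

/-- A clopen subscheme of an abstractly smoothable scheme is abstractly smoothable. -/
theorem AbstractlySmoothable.of_isClosed {k : Type u} [Field k] {R : Scheme.{u}}
    {f : R ⟶ Spec (.of k)} (h : AbstractlySmoothable f) (U : R.Opens) (hU : IsClosed (U : Set R)) :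
    AbstractlySmoothable (U.ι ≫ f) := by
  let U' : R.Opens := ⟨(U : Set R)ᶜ, hU.isOpen_compl⟩
  have hc : IsCompl U.ι.opensRange U'.ι.opensRange := by
    rw [Scheme.Opens.opensRange_ι, Scheme.Opens.opensRange_ι]
    refine ⟨?_, ?_⟩
    · rw [disjoint_iff]
      exact TopologicalSpace.Opens.ext (Set.inter_compl_self _)
    · rw [codisjoint_iff]
      exact TopologicalSpace.Opens.ext (Set.union_compl_self _)
  obtain ⟨hcol⟩ := nonempty_isColimit_binaryCofanMk_of_isCompl U.ι U'.ι hc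
  let e (b : Bool) : Spec (.of k) ⟶ Spec (.of (Bool → k)) :=
    Spec.map (CommRingCat.ofHom (Pi.evalRingHom (fun _ : Bool ↦ k) b))
  have he (b : Bool) : e b ≫ Spec.map (CommRingCat.ofHom (algebraMap k (Bool → k))) = 𝟙 _ := by
    rw [← Spec.map_comp, ← CommRingCat.ofHom_comp]
    exact Spec.map_id _
  -- A morphism to two copies of `Spec k` that separates `U` from its complement; the target is
  -- smooth and affine.
  let g : R ⟶ Spec (.of (Bool → k)) :=
    hcol.desc (BinaryCofan.mk (U.ι ≫ f ≫ e true) (U'.ι ≫ f ≫ e false))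
  have hg₁ : U.ι ≫ g = U.ι ≫ f ≫ e true := hcol.fac _ ⟨.left⟩
  have hg₂ : U'.ι ≫ g = U'.ι ≫ f ≫ e false := hcol.fac _ ⟨.right⟩
  have hg : g ≫ Spec.map (CommRingCat.ofHom (algebraMap k (Bool → k))) = f := by
    apply BinaryCofan.IsColimit.hom_ext hcol
    · change U.ι ≫ _ = U.ι ≫ _
      rw [reassoc_of% hg₁, he, Category.comp_id]
    · change U'.ι ≫ _ = U'.ι ≫ _
      rw [reassoc_of% hg₂, he, Category.comp_id]
  let D : (Spec (.of (Bool → k))).Opens := PrimeSpectrum.basicOpen (Pi.single true 1 : Bool → k)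
  have hD : IsClosed (D : Set (Spec (.of (Bool → k)))) := by
    refine (PrimeSpectrum.isClopen_iff.mpr ⟨(Pi.single true 1 : Bool → k), ?_, rfl⟩).1
    rw [IsIdempotentElem, ← Pi.single_mul, one_mul]
  have hgD : g ⁻¹ᵁ D = U := by
    ext x
    by_cases hx : x ∈ U
    · refine iff_of_true ?_ hx
      have : g x = e true (f x) := congr($hg₁ ⟨x, hx⟩)
      change g x ∈ D
      rw [this]
      intro h0
      refine (f x).isPrime.ne_top ((Ideal.eq_top_iff_one _).mpr ?_)
      have h1 : Pi.evalRingHom (fun _ : Bool ↦ k) true (Pi.single true 1) ∈ (f x).asIdeal := h0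
      simpa using h1
    · refine iff_of_false ?_ hx
      have : g x = e false (f x) := congr($hg₂ ⟨x, hx⟩)
      change ¬ g x ∈ D
      rw [this]
      intro h0
      apply h0
      change Pi.evalRingHom (fun _ : Bool ↦ k) false (Pi.single true 1) ∈ (f x).asIdeal
      simp
  obtain ⟨A, _, _, _, _, ε, Z, π, i, φ, hs, hi, -⟩ := h.mapSmoothable g hg
  -- The preimage of `D` under the extension `φ` is a clopen part of the total space which cuts out
  -- `U` in the special fibre.
  have hiD : i ⁻¹ᵁ φ ⁻¹ᵁ D = U := by
    rw [← Scheme.Hom.comp_preimage, hi, hgD]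
  rw [hg] at hs
  have := hs.restrict (φ ⁻¹ᵁ D) (hD.preimage φ.continuous)
  rw [← hiD]
  exact ⟨_, _, _, _, _, _, this⟩

/-- The inclusion of an abstractly smoothable one-point scheme into a smooth scheme extends to an
abstract smoothing. -/
theorem AbstractlySmoothable.mapSmoothable_of_subsingleton {k : Type u} [Field k]
    {R X : Scheme.{u}} [Subsingleton R] {p : X ⟶ Spec (.of k)} [Smooth p] {g : R ⟶ X}
    (h : AbstractlySmoothable (g ≫ p)) : MapSmoothable p g := by
  cases isEmpty_or_nonempty R with
  | inl _ => exact .of_isEmpty p g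
  | inr hne =>
  obtain ⟨x⟩ := hne
  -- A one-point scheme maps into a single affine open of `X`, which is where the extension
  -- principle applies.
  obtain ⟨V, hV, hxV, -⟩ := X.isBasis_affineOpens.exists_subset_of_mem_open
    (Set.mem_univ (g x)) isOpen_univ
  obtain ⟨V, hV, rfl⟩ := hV
  have hV : IsAffineOpen V := hV
  have hr : Set.range g ⊆ Set.range hV.fromSpec := by
    rw [hV.range_fromSpec]
    rintro _ ⟨y, rfl⟩
    rwa [Subsingleton.elim y x]
  let l : R ⟶ Spec Γ(X, V) := IsOpenImmersion.lift hV.fromSpec g hr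
  have hl : l ≫ hV.fromSpec = g := IsOpenImmersion.lift_fac _ _ _
  let S : CommRingCat.{u} := Γ(X, V)
  let α : CommRingCat.of k ⟶ S := Spec.preimage (hV.fromSpec ≫ p)
  have hα : Spec.map α = hV.fromSpec ≫ p := Spec.map_preimage _
  let _ : Algebra k S := α.hom.toAlgebra
  have : Smooth (Spec.map α) := hα ▸ inferInstance
  have : Algebra.Smooth k S := (HasRingHomProperty.Spec_iff (P := @Smooth.{u})).mp this
  have hm : MapSmoothable (Spec.map (CommRingCat.ofHom (algebraMap k S))) l := by
    refine h.mapSmoothable l ?_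
    rw [← hl, Category.assoc, ← hα]
    rfl
  have hm' : MapSmoothable (hV.fromSpec ≫ p) l := hα ▸ hm
  rw [← hl]
  exact hm'.comp

theorem MapSmoothable.of_opens_sup {k : Type u} [Field k] {R X : Scheme.{u}}
    {p : X ⟶ Spec (.of k)} {g : R ⟶ X} {U V : R.Opens} (hUV : Disjoint U V)
    (hU : MapSmoothable p (U.ι ≫ g)) (hV : MapSmoothable p (V.ι ≫ g)) :
    MapSmoothable p ((U ⊔ V).ι ≫ g) := by
  have hc : IsCompl (R.homOfLE (le_sup_left : U ≤ U ⊔ V)).opensRange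
      (R.homOfLE (le_sup_right : V ≤ U ⊔ V)).opensRange := by
    rw [Scheme.opensRange_homOfLE, Scheme.opensRange_homOfLE]
    refine ⟨?_, ?_⟩
    · rw [disjoint_iff, ← Scheme.Hom.preimage_inf, hUV.eq_bot, Scheme.Hom.preimage_bot]
    · rw [codisjoint_iff, ← Scheme.Hom.preimage_sup, Scheme.Opens.ι_preimage_self]
  obtain ⟨hcol⟩ := nonempty_isColimit_binaryCofanMk_of_isCompl _ _ hc
  refine .of_isColimit_binaryCofan hcol ?_ ?_
  · rwa [← Category.assoc, Scheme.homOfLE_ι]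
  · rwa [← Category.assoc, Scheme.homOfLE_ι]

/-- A morphism from a finite discrete scheme extends to an abstract smoothing if its restrictions
to all points do. -/
theorem MapSmoothable.of_forall_point {k : Type u} [Field k] {R X : Scheme.{u}} [Finite R]
    [DiscreteTopology R] {p : X ⟶ Spec (.of k)} {g : R ⟶ X}
    (h : ∀ x : R, MapSmoothable p (Scheme.Opens.ι ⟨{x}, isOpen_discrete _⟩ ≫ g)) :
    MapSmoothable p g := by
  have key (s : Set R) (hs : s.Finite) :
      MapSmoothable p (Scheme.Opens.ι (X := R) ⟨s, isOpen_discrete _⟩ ≫ g) := by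
    induction s, hs using Set.Finite.induction_on with
    | empty =>
      have : IsEmpty (Scheme.Opens.toScheme (X := R) ⟨∅, isOpen_discrete _⟩) :=
        ⟨fun x ↦ x.2⟩
      exact .of_isEmpty _ _
    | @insert a s ha hs ih =>
      refine .of_opens_sup (U := ⟨{a}, isOpen_discrete _⟩) (V := ⟨s, isOpen_discrete _⟩) ?_ (h a) ih
      rw [disjoint_iff]
      exact TopologicalSpace.Opens.ext (Set.singleton_inter_eq_empty.mpr ha)
  have htop : MapSmoothable p ((⊤ : R.Opens).ι ≫ g) := key Set.univ Set.finite_univ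
  -- Viewing `R` as the disjoint union of `⊤` and `⊥` passes from the open subscheme `⊤` to `R`
  -- itself.
  have hc : IsCompl (⊤ : R.Opens).ι.opensRange (⊥ : R.Opens).ι.opensRange := by
    rw [Scheme.Opens.opensRange_ι, Scheme.Opens.opensRange_ι]
    exact isCompl_top_bot
  obtain ⟨hcol⟩ := nonempty_isColimit_binaryCofanMk_of_isCompl _ _ hc
  have : IsEmpty (⊥ : R.Opens).toScheme := ⟨fun x ↦ x.2⟩
  exact .of_isColimit_binaryCofan hcol htop (.of_isEmpty _ _)

theorem EmbeddedSmoothable.abstractlySmoothable {k : Type u} [Field k] {R X : Scheme.{u}}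
    {p : X ⟶ Spec (.of k)} {ι : R ⟶ X} (h : EmbeddedSmoothable p ι) :
    AbstractlySmoothable (ι ≫ p) := by
  obtain ⟨T, Z, q, j, t, i, -, h, -⟩ := h
  exact ⟨T, Z, q, _, t, i, h⟩

theorem component_eq {k : Type u} [Field k] {R : Scheme.{u}} (f : R ⟶ Spec (.of k)) [IsFinite f]
    [DiscreteTopology R] (x : R) : component f x = ⟨{x}, isOpen_discrete _⟩ :=
  TopologicalSpace.Opens.ext (connectedComponent_eq_singleton x)

end Smoothability

/-! ### The equivalence of the four conditions. -/

theorem mainTheorem3 {k : Type u} [Field k] {X R : Scheme.{u}}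
    (p : X ⟶ Spec (.of k)) [Smooth p] [IsSeparated p] [QuasiCompact p]
    (ι : R ⟶ X) [IsClosedImmersion ι] [IsFinite (ι ≫ p)] :
    List.TFAE [
      Smoothability.AbstractlySmoothable (ι ≫ p),
      Smoothability.EmbeddedSmoothable p ι,
      ∀ x : R, Smoothability.AbstractlySmoothable
        ((Smoothability.component (ι ≫ p) x).ι ≫ ι ≫ p),
      ∀ x : R, Smoothability.EmbeddedSmoothable p
        ((Smoothability.component (ι ≫ p) x).ι ≫ ι)] := by
  have : DiscreteTopology R := Smoothability.discreteTopology_of_isFinite (ι ≫ p)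
  have : CompactSpace R := QuasiCompact.compactSpace_of_compactSpace (ι ≫ p)
  have : Finite R := finite_of_compact_of_discrete
  have hsub (x : R) : Subsingleton (Smoothability.component (ι ≫ p) x) := by
    rw [Smoothability.component_eq]
    exact inferInstanceAs (Subsingleton ({x} : Set R))
  have hmap (H : ∀ x : R, Smoothability.AbstractlySmoothable
      ((Smoothability.component (ι ≫ p) x).ι ≫ ι ≫ p)) (x : R) :
      Smoothability.MapSmoothable p ((Smoothability.component (ι ≫ p) x).ι ≫ ι) := by
    refine Smoothability.AbstractlySmoothable.mapSmoothable_of_subsingleton ?_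
    rw [Category.assoc]
    exact H x
  tfae_have 1 → 3 := fun h x ↦ h.of_isClosed _ (isClosed_discrete _)
  tfae_have 3 → 4 := fun H x ↦ by
    have : IsClosedImmersion (Smoothability.component (ι ≫ p) x).ι := by
      refine IsClosedImmersion.of_isPreimmersion _ (isClosed_discrete _)
    exact (hmap H x).embeddedSmoothable
  tfae_have 4 → 2 := fun H ↦ by
    refine Smoothability.MapSmoothable.embeddedSmoothable (.of_forall_point fun x ↦ ?_)
    rw [← Smoothability.component_eq (ι ≫ p)]
    -- The given embedded families are used only as abstract smoothings; extended morphisms are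
    -- rebuilt from them, and a closed embedding is recovered only after taking the disjoint union.
    refine hmap (fun y ↦ ?_) x
    rw [← Category.assoc]
    exact (H y).abstractlySmoothable
  tfae_have 2 → 1 := fun h ↦ h.abstractlySmoothable
  tfae_finish
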